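/- Let $d\ge 1$ and $C>0$. There is a constant $C_0>0$, depending only on $d$ and $C$, such that the following holds. Let $K\subset\mathbb R^d$ be compact with Euclidean diameter $T=\operatorname{diam}K>0$, and let $q:[0,T]\to[0,\infty)$ be a gauge function, i.e. continuous and strictly increasing with $q(0)=0$, such that (q1) $\tau\mapsto q(\tau)\sqrt{-\log\tau}$ is non-decreasing on a right neighbourhood of $0$; (q2) $\lim_{\tau\downarrow0}q(\tau)\sqrt{-\log\tau}=0$; (q3) for a constant $C_1>0$ and all sufficiently small $\tau>0$, $$\int_0^\tau \frac{q(\rho)}{\rho\sqrt{\log(T/\rho)}}\,d\rho\le C_1\,q(\tau)\sqrt{\log(T/\tau)}<\infty .$$ Let $X=\{X(x):x\in K\}$ be a separable centered real-valued Gaussian random field whose canonical metric $\mathfrak d_{x,\bar x}=\|X(x)-X(\bar x)\|_{L^2(\Omega)}$ satisfies $\mathfrak d_{x,\bar x}\le C\,q(|x-\bar x|)$ for all $x,\bar x\in K$. (Separable: there are a countable dense $D\subset K$ and a null event outside of which, for all relatively open $U\subset K$ and closed $F\subset\mathbb R$, $X(s)\in F$ for all $s\in D\cap U$ implies $X(x)\in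 F$ for all $x\in U$; for example, $X$ has a.s. continuous paths.) Then $C_0$ is a constant for the Dudley bound: almost surely there is $\eta>0$ with $$\sup_{x,\bar x\in K,\ \mathfrak d_{x,\bar x}\le\varepsilon}|X(x)-X(\bar x)|\le C_0\int_0^\varepsilon\sqrt{\log\Big(\frac{T}{q^{-1}(\rho)}\Big)}\,d\rho,\qquad \varepsilon\in(0,\eta),$$ and, with this $C_0$, almost surely $$\lim_{\varepsilon\downarrow0}\ \sup_{x,\bar x\in K,\ \mathfrak d_{x,\bar x}\le\varepsilon}\frac{|X(x)-X(\bar x)|}{\mathfrak d_{x,\bar x}\sqrt{\log\big(T/q^{-1}(\mathfrak d_{x,\bar x})\big)}}\le C_0(C_1+1),$$ where the limit exists, and a quotient with denominator $0$ (for $\mathfrak d_{x,\bar x}=0$) counts as $0$ if its numerator is $0$ and as $+\infty$ otherwise. -/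

import Mathlib

open MeasureTheory ProbabilityTheory Filter Set
open scoped Topology ENNReal

noncomputable section

/-- A gauge function on `[0, T]`, `T > 0`: continuous, strictly increasing, vanishing at `0`.
Only the values of `q` on `[0, T]` matter. -/
structure IsGauge (T : ℝ) (q : ℝ → ℝ) : Prop where
  pos : 0 < T
  continuousOn : ContinuousOn q (Icc 0 T)
  strictMonoOn : StrictMonoOn q (Icc 0 T)
  map_zero : q 0 = 0

/-- The inverse `q⁻¹ : [0, q T] → [0, T]` of a gauge function. -/
def gaugeInv (T : ℝ) (q : ℝ → ℝ) : ℝ → ℝ := Function.invFunOn q (Icc 0 T)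

/-- Condition (q1): `τ ↦ q τ * √(-log τ)` is non-decreasing near zero. -/
def CondQ1 (T : ℝ) (q : ℝ → ℝ) : Prop :=
  ∃ τ₀ ∈ Ioc 0 T, MonotoneOn (fun τ => q τ * √(-Real.log τ)) (Ioc 0 τ₀)

/-- Condition (q2): `q τ * √(-log τ) → 0` as `τ ↓ 0`. -/
def CondQ2 (q : ℝ → ℝ) : Prop :=
  Tendsto (fun τ => q τ * √(-Real.log τ)) (𝓝[>] 0) (𝓝 0)

/-- Condition (q3) with constant `C₁`, for all sufficiently small `τ > 0`. (At `τ = T` the right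
hand side is zero and the left hand side is positive, so it cannot be asked on all of `[0, T]`.)
The integral is required to converge. -/
def CondQ3 (T : ℝ) (q : ℝ → ℝ) (C₁ : ℝ) : Prop :=
  ∃ τ₀ ∈ Ioc 0 T, ∀ τ ∈ Ioc 0 τ₀,
    IntegrableOn (fun ρ => q ρ * (ρ * √(Real.log (T / ρ)))⁻¹) (Ioc 0 τ) ∧
    ∫ ρ in Ioc 0 τ, q ρ * (ρ * √(Real.log (T / ρ)))⁻¹ ≤ C₁ * q τ * √(Real.log (T / τ))

section Fields

variable {d : ℕ} {K : Set (EuclideanSpace ℝ (Fin d))} {Ω : Type*} [MeasurableSpace Ω]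

/-- The canonical metric `‖X x - X y‖_{L²(Ω)}` of a random field. -/
def canonicalMetric (P : Measure Ω) (X : K → Ω → ℝ) (x y : K) : ℝ :=
  (eLpNorm (fun ω => X x ω - X y ω) 2 P).toReal

/-- A centered Gaussian random field on `K` whose canonical metric is at most `C * q (|x - y|)`. -/
structure IsCenteredHatGaussian (P : Measure Ω) (X : K → Ω → ℝ) (q : ℝ → ℝ) (C : ℝ) : Prop where
  gaussian : IsGaussianProcess X P
  centered : ∀ x, ∫ ω, X x ω ∂P = 0
  metric_le : ∀ x y, canonicalMetric P X x y ≤ C * q (dist x y)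

/-- Separability of a random field (Doob): outside of one null event, closed constraints on the
values of the field over an open set can be tested on a fixed countable dense set. Every field with
almost surely continuous sample paths is separable. -/
def IsSeparableField (P : Measure Ω) (X : K → Ω → ℝ) : Prop :=
  ∃ D : Set K, D.Countable ∧ Dense D ∧
    ∀ᵐ ω ∂P, ∀ (U : Set K) (F : Set ℝ), IsOpen U → IsClosed F →
      (∀ s ∈ D ∩ U, X s ω ∈ F) → ∀ x ∈ U, X x ω ∈ F

/-- The Dudley-type entropy bound with constant `C₀`: almost surely there is a (random) `η > 0`
such that for `0 < ε < η` the supremum of `|X x - X y|` over the pairs at canonical distance at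
most `ε` is at most `C₀ * ∫₀^ε √(log (diam K / q⁻¹ ρ)) dρ`. -/
def DudleyBound (P : Measure Ω) (X : K → Ω → ℝ) (q : ℝ → ℝ) (C₀ : ℝ) : Prop :=
  ∀ᵐ ω ∂P, ∃ η > 0, ∀ ε ∈ Ioo 0 η, ∀ x y : K, canonicalMetric P X x y ≤ ε →
    |X x ω - X y ω| ≤
      C₀ * ∫ ρ in Ioc 0 ε, √(Real.log (Metric.diam K / gaugeInv (Metric.diam K) q ρ))

/-- The supremum, over the pairs `x, y ∈ K` at canonical distance at most `ε`, of
`|X x - X y| / (δ * √(log (diam K / q⁻¹ δ)))`, where `δ` is the canonical distance of `x` and `y`.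
It takes values in `[0, ∞]`; a quotient `0 / 0` counts as `0` and `a / 0` with `a > 0` as `∞`. -/
def normalizedSup (P : Measure Ω) (X : K → Ω → ℝ) (q : ℝ → ℝ) (ε : ℝ) (ω : Ω) : ℝ≥0∞ :=
  ⨆ (x : K) (y : K) (_ : canonicalMetric P X x y ≤ ε),
    ENNReal.ofReal |X x ω - X y ω| /
      ENNReal.ofReal (canonicalMetric P X x y *
        √(Real.log (Metric.diam K / gaugeInv (Metric.diam K) q (canonicalMetric P X x y))))

end Fields

end

/-! The proof is by chaining along the scales r_n = T exp(-4ⁿ), where √log(T/r_n) = 2ⁿ and K has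
r_n-nets of at most B exp(d 4ⁿ) points. A Gaussian tail at level t 2ⁿ is of order exp(-t² 4ⁿ/2).
Once t² ≥ 2(8d+1), Borel-Cantelli (`ae_eventually_le`) bounds, for all large n, every increment
between points of two consecutive nets by t 2ⁿ times its canonical distance. Links at level k have
canonical length at most 2C q(r_k), so a chain from level n costs a multiple of the sum of 2ᵏ q(r_k)
over k ≥ n, and `sum_doublingScale_le` bounds this sum by twice the entropy integral up to q(r_n).
Chains end at points of the countable separating set, and separability carries the estimate to all
of K. For q(r_{n+1}) ≤ ε < q(r_n), two chains and one increment inside the net of level n+1 give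
`dudleyBound`.

For the normalized supremum, `integrableOn_gaugeEntropy` turns (q3) into a bound of the entropy
integral up to q(τ) by 2(C₁+1) q(τ)√log(T/τ). Both integrals are compared with one geometric sum, a
discrete integration by parts that needs no derivative of q. The Dudley bound is then used with ε
equal to the canonical distance of the pair. -/

/-! ### Covering numbers of bounded sets. -/

/-- A bounded set in `ℝᵈ` has `r`-nets of cardinality `O((1 + 1/r)ᵈ)`. -/
theorem exists_finset_net {d : ℕ} {K : Set (EuclideanSpace ℝ (Fin d))}
    (hK : Bornology.IsBounded K) (hne : K.Nonempty) :
    ∃ R : ℝ, 0 ≤ R ∧ ∀ r : ℝ, 0 < r → ∃ N : Finset K,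
      (∀ x : K, ∃ u ∈ N, dist x u ≤ r) ∧ (N.card : ℝ) ≤ (R / r + 3) ^ d := by
  classical
  obtain ⟨M, hM⟩ := hK.exists_norm_le
  have hM0 : 0 ≤ M := by
    obtain ⟨x, hx⟩ := hne
    exact (norm_nonneg x).trans (hM x hx)
  have : Nonempty K := hne.to_subtype
  refine ⟨2 * M * (d + 1), by positivity, fun r hr => ?_⟩
  -- A grid cell of side h has diameter √d h ≤ r; d + 1 in place of √d avoids roots and division by
  -- zero.
  set h : ℝ := r / (d + 1) with hh
  have hh0 : 0 < h := by positivity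
  set b : ℤ := ⌈M / h⌉ with hb
  have hb0 : 0 ≤ b := Int.ceil_nonneg (by positivity)
  let g : K → Fin d → ℤ := fun x i => ⌊(x : EuclideanSpace ℝ (Fin d)) i / h⌋
  let S : Finset (Fin d → ℤ) := Fintype.piFinset fun _ => Finset.Ico (-b) (b + 1)
  have hgS : ∀ x, g x ∈ S := by
    intro x
    simp only [S, g, Fintype.mem_piFinset, Finset.mem_Ico]
    intro i
    have h1 : |(x : EuclideanSpace ℝ (Fin d)) i| ≤ M := by
      have := (PiLp.norm_apply_le (x : EuclideanSpace ℝ (Fin d)) i).trans (hM x x.2)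
      rwa [Real.norm_eq_abs] at this
    have h2 : M / h ≤ b := Int.le_ceil _
    rw [abs_le] at h1
    constructor
    · rw [Int.le_floor]
      push_cast
      have : -(M / h) ≤ (x : EuclideanSpace ℝ (Fin d)) i / h := by
        rw [← neg_div]; gcongr; exact h1.1
      linarith
    · rw [Int.floor_lt]
      push_cast
      have : (x : EuclideanSpace ℝ (Fin d)) i / h ≤ M / h := by gcongr; exact h1.2
      linarith
  -- One point of K is chosen per occupied cell. Empty cells contribute an arbitrary point of K,
  -- harmless for an upper bound on the cardinality.
  refine ⟨S.image (Function.invFun g), fun x => ?_, ?_⟩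
  · refine ⟨Function.invFun g (g x), Finset.mem_image_of_mem _ (hgS x), ?_⟩
    have hgu : g (Function.invFun g (g x)) = g x := Function.invFun_eq ⟨x, rfl⟩
    set u := Function.invFun g (g x)
    rw [Subtype.dist_eq, EuclideanSpace.dist_eq]
    apply Real.sqrt_le_iff.2 ⟨hr.le, ?_⟩
    have hi : ∀ i, dist ((x : EuclideanSpace ℝ (Fin d)) i) ((u : EuclideanSpace ℝ (Fin d)) i) ^ 2
        ≤ h ^ 2 := by
      intro i
      have h1 : ⌊(u : EuclideanSpace ℝ (Fin d)) i / h⌋ = ⌊(x : EuclideanSpace ℝ (Fin d)) i / h⌋ :=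
        congrFun hgu i
      have h2 := (Int.abs_sub_lt_one_of_floor_eq_floor h1).le
      rw [← sub_div, abs_div, abs_of_pos hh0, div_le_one hh0] at h2
      rw [Real.dist_eq, abs_sub_comm]
      gcongr
    calc _ ≤ ∑ _i : Fin d, h ^ 2 := Finset.sum_le_sum fun i _ => hi i
      _ = d * h ^ 2 := by simp
      _ ≤ (d + 1) ^ 2 * h ^ 2 := by
          gcongr
          nlinarith [(Nat.cast_nonneg d : (0 : ℝ) ≤ d)]
      _ = r ^ 2 := by rw [hh]; field_simp
  · have h1 : ((S.image (Function.invFun g)).card : ℝ) ≤ S.card := by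
      exact_mod_cast Finset.card_image_le
    refine h1.trans ?_
    have h2 : (S.card : ℝ) = (2 * b + 1) ^ d := by
      have h3 : ((b + 1 - -b).toNat : ℤ) = 2 * b + 1 := by
        rw [Int.toNat_of_nonneg (by omega)]; ring
      simp only [S, Fintype.card_piFinset, Int.card_Ico, Finset.prod_const, Finset.card_univ,
        Fintype.card_fin]
      push_cast
      congr 1
      exact_mod_cast h3
    rw [h2]
    have h4 : (b : ℝ) < M / h + 1 := Int.ceil_lt_add_one _
    have h5 : (0 : ℝ) ≤ b := by exact_mod_cast hb0
    have h6 : 2 * M * (d + 1) / r = 2 * (M / h) := by rw [hh]; field_simp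
    rw [h6]
    exact pow_le_pow_left₀ (by positivity) (by linarith) d

/-! ### The entropy integrand of a gauge. -/

/-- The square root of the logarithm of the inverse gauge: the integrand of the entropy integral. -/
noncomputable def gaugeEntropy (T : ℝ) (q : ℝ → ℝ) (ρ : ℝ) : ℝ := √(Real.log (T / gaugeInv T q ρ))

namespace IsGauge

variable {T : ℝ} {q : ℝ → ℝ}

theorem monotoneOn (h : IsGauge T q) : MonotoneOn q (Icc 0 T) := h.strictMonoOn.monotoneOn

theorem apply_pos (h : IsGauge T q) {τ : ℝ} (hτ : τ ∈ Ioc 0 T) : 0 < q τ := by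
  have := h.strictMonoOn ⟨le_rfl, h.pos.le⟩ ⟨hτ.1.le, hτ.2⟩ hτ.1
  rwa [h.map_zero] at this

theorem gaugeInv_apply (h : IsGauge T q) {τ : ℝ} (hτ : τ ∈ Icc 0 T) : gaugeInv T q (q τ) = τ :=
  h.strictMonoOn.injOn.leftInvOn_invFunOn hτ

theorem exists_eq (h : IsGauge T q) {ρ : ℝ} (hρ : ρ ∈ Ioc 0 (q T)) : ∃ τ ∈ Ioc 0 T, q τ = ρ := by
  have h1 := intermediate_value_Icc h.pos.le h.continuousOn
  rw [h.map_zero] at h1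
  obtain ⟨τ, hτ, rfl⟩ := h1 ⟨hρ.1.le, hρ.2⟩
  refine ⟨τ, ⟨lt_of_le_of_ne hτ.1 ?_, hτ.2⟩, rfl⟩
  rintro rfl
  exact hρ.1.ne' h.map_zero

theorem gaugeEntropy_apply (h : IsGauge T q) {τ : ℝ} (hτ : τ ∈ Icc 0 T) :
    gaugeEntropy T q (q τ) = √(Real.log (T / τ)) := by
  rw [gaugeEntropy, h.gaugeInv_apply hτ]

theorem antitoneOn_gaugeEntropy (h : IsGauge T q) :
    AntitoneOn (gaugeEntropy T q) (Ioc 0 (q T)) := by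
  intro x hx y hy hxy
  obtain ⟨a, ha, rfl⟩ := h.exists_eq hx
  obtain ⟨b, hb, rfl⟩ := h.exists_eq hy
  have ha' : a ∈ Icc 0 T := ⟨ha.1.le, ha.2⟩
  have hb' : b ∈ Icc 0 T := ⟨hb.1.le, hb.2⟩
  rw [h.gaugeEntropy_apply ha', h.gaugeEntropy_apply hb']
  have hab : a ≤ b := (h.strictMonoOn.le_iff_le ha' hb').1 hxy
  have hT := h.pos
  have := ha.1
  have := hb.1
  gcongr

theorem tendsto_zero (h : IsGauge T q) : Tendsto q (𝓝[>] 0) (𝓝 0) := by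
  have h1 := h.continuousOn 0 ⟨le_rfl, h.pos.le⟩
  rw [ContinuousWithinAt, h.map_zero] at h1
  refine h1.mono_left ?_
  rw [← nhdsWithin_Ioc_eq_nhdsGT h.pos]
  exact nhdsWithin_mono _ Ioc_subset_Icc_self

end IsGauge

theorem gaugeEntropy_nonneg (T : ℝ) (q : ℝ → ℝ) (ρ : ℝ) : 0 ≤ gaugeEntropy T q ρ :=
  Real.sqrt_nonneg _

/-! ### Doubling scales. -/

/-- The scales `T * exp (-4ᵏ s)`, along which `√(log (T / ·))` doubles. -/
noncomputable def doublingScale (T s : ℝ) (k : ℕ) : ℝ := T * Real.exp (-(4 ^ k * s))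

section doublingScale

variable {T s : ℝ}

theorem doublingScale_pos (hT : 0 < T) (k : ℕ) : 0 < doublingScale T s k := by
  unfold doublingScale; positivity

theorem doublingScale_lt (hT : 0 < T) (hs : 0 < s) (k : ℕ) : doublingScale T s k < T := by
  unfold doublingScale
  refine mul_lt_of_lt_one_right hT (Real.exp_lt_one_iff.2 ?_)
  have : 0 < 4 ^ k * s := by positivity
  linarith

theorem doublingScale_mem (hT : 0 < T) (hs : 0 < s) (k : ℕ) : doublingScale T s k ∈ Ioc 0 T :=
  ⟨doublingScale_pos hT k, (doublingScale_lt hT hs k).le⟩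

theorem doublingScale_mem_Icc (hT : 0 < T) (hs : 0 < s) (k : ℕ) : doublingScale T s k ∈ Icc 0 T :=
  ⟨(doublingScale_pos hT k).le, (doublingScale_lt hT hs k).le⟩

theorem antitone_doublingScale (hT : 0 < T) (hs : 0 < s) : Antitone (doublingScale T s) := by
  intro m n hmn
  unfold doublingScale
  gcongr
  norm_num

theorem sqrt_log_doublingScale (hT : 0 < T) (k : ℕ) :
    √(Real.log (T / doublingScale T s k)) = 2 ^ k * √s := by
  have h1 : T / doublingScale T s k = Real.exp (4 ^ k * s) := by
    rw [doublingScale, Real.exp_neg]; field_simp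
  rw [h1, Real.log_exp, Real.sqrt_mul (by positivity), show (4 : ℝ) ^ k = (2 ^ k) ^ 2 by
    rw [← pow_mul, mul_comm, pow_mul]; norm_num, Real.sqrt_sq (by positivity)]

theorem tendsto_doublingScale (hs : 0 < s) : Tendsto (doublingScale T s) atTop (𝓝 0) := by
  have h1 : Tendsto (fun k : ℕ => (4 : ℝ) ^ k * s) atTop atTop :=
    (tendsto_pow_atTop_atTop_of_one_lt (by norm_num)).atTop_mul_const hs
  have h2 := (Real.tendsto_exp_neg_atTop_nhds_zero.comp h1).const_mul T
  rw [mul_zero] at h2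
  exact h2

end doublingScale

/-! ### Sums over doubling scales against the entropy integral. -/

namespace IsGauge

variable {T : ℝ} {q : ℝ → ℝ}

theorem integrableOn_gaugeEntropy_Ioc (h : IsGauge T q) {a b : ℝ} (ha : 0 < a) (hb : b ≤ q T) :
    IntegrableOn (gaugeEntropy T q) (Ioc a b) := by
  refine IntegrableOn.mono_set ?_ Ioc_subset_Icc_self
  refine AntitoneOn.integrableOn_isCompact isCompact_Icc (h.antitoneOn_gaugeEntropy.mono ?_)
  exact fun x hx => ⟨ha.trans_le hx.1, hx.2.trans hb⟩

/-- Lower bound of the entropy integral on an interval by its smallest value. -/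
theorem mul_gaugeEntropy_le_setIntegral (h : IsGauge T q) {a b : ℝ} (hab : a ≤ b) (ha : 0 ≤ a)
    (hb : b ∈ Ioc 0 (q T)) (hint : IntegrableOn (gaugeEntropy T q) (Ioc a b)) :
    (b - a) * gaugeEntropy T q b ≤ ∫ ρ in Ioc a b, gaugeEntropy T q ρ := by
  have h1 : ∫ _ρ in Ioc a b, gaugeEntropy T q b = (b - a) * gaugeEntropy T q b := by
    simp [hab]
  rw [← h1]
  refine setIntegral_mono_on (by simp) hint measurableSet_Ioc fun x hx => ?_
  exact h.antitoneOn_gaugeEntropy ⟨ha.trans_lt hx.1, hx.2.trans hb.2⟩ hb hx.2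

/-- Upper bound of the entropy integral on an interval by its largest value. -/
theorem setIntegral_le_mul_gaugeEntropy (h : IsGauge T q) {a b : ℝ} (hab : a ≤ b) (ha : 0 < a)
    (hb : b ≤ q T) :
    ∫ ρ in Ioc a b, gaugeEntropy T q ρ ≤ (b - a) * gaugeEntropy T q a := by
  have h1 : ∫ _ρ in Ioc a b, gaugeEntropy T q a = (b - a) * gaugeEntropy T q a := by
    simp [hab]
  rw [← h1]
  refine setIntegral_mono_on (h.integrableOn_gaugeEntropy_Ioc ha hb) (by simp) measurableSet_Ioc
    fun x hx => ?_
  exact h.antitoneOn_gaugeEntropy ⟨ha, hab.trans hb⟩ ⟨ha.trans hx.1, hx.2.trans hb⟩ hx.1.le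

/-- The sum over doubling scales is at most twice the entropy integral. -/
theorem sum_doublingScale_le (h : IsGauge T q) (m : ℕ) : ∀ n : ℕ,
    IntegrableOn (gaugeEntropy T q) (Ioc 0 (q (doublingScale T 1 n))) →
    (q (doublingScale T 1 n) * 2 ^ n +
      ∑ k ∈ Finset.range (m + 1), q (doublingScale T 1 (n + k)) * 2 ^ (n + k)) / 2 ≤
      ∫ ρ in Ioc 0 (q (doublingScale T 1 n)), gaugeEntropy T q ρ := by
  have hmem := doublingScale_mem h.pos one_pos
  have hmem' := doublingScale_mem_Icc h.pos one_pos
  have hE : ∀ n, gaugeEntropy T q (q (doublingScale T 1 n)) = 2 ^ n := fun n => by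
    rw [h.gaugeEntropy_apply (hmem' n), sqrt_log_doublingScale h.pos]; simp
  have hb : ∀ n, q (doublingScale T 1 n) ∈ Ioc 0 (q T) := fun n =>
    ⟨h.apply_pos (hmem n), h.monotoneOn (hmem' n) ⟨h.pos.le, le_rfl⟩ (hmem n).2⟩
  induction m with
  | zero =>
    intro n hint
    have := h.mul_gaugeEntropy_le_setIntegral (hb n).1.le le_rfl (hb n) hint
    rw [hE] at this
    simp
    linarith
  | succ m ih =>
    intro n hint
    have hle : q (doublingScale T 1 (n + 1)) ≤ q (doublingScale T 1 n) :=
      h.monotoneOn (hmem' _) (hmem' _) (antitone_doublingScale h.pos one_pos n.le_succ)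
    have hu : Ioc 0 (q (doublingScale T 1 n)) =
        Ioc 0 (q (doublingScale T 1 (n + 1))) ∪
          Ioc (q (doublingScale T 1 (n + 1))) (q (doublingScale T 1 n)) :=
      (Ioc_union_Ioc_eq_Ioc (hb _).1.le hle).symm
    have hi1 := hint.mono_set (hu ▸ subset_union_left)
    have hi2 := hint.mono_set (hu ▸ subset_union_right)
    have h1 := ih (n + 1) hi1
    have h2 := h.mul_gaugeEntropy_le_setIntegral hle (hb _).1.le (hb n) hi2
    rw [hE] at h2
    rw [hu, setIntegral_union (Ioc_disjoint_Ioc_of_le le_rfl) measurableSet_Ioc hi1 hi2,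
      Finset.sum_range_succ']
    have h3 : ∑ k ∈ Finset.range (m + 1), q (doublingScale T 1 (n + (k + 1))) * 2 ^ (n + (k + 1)) =
        ∑ k ∈ Finset.range (m + 1), q (doublingScale T 1 (n + 1 + k)) * 2 ^ (n + 1 + k) :=
      Finset.sum_congr rfl fun k _ => by rw [show n + (k + 1) = n + 1 + k by ring]
    rw [h3]
    -- The additional boundary term makes the induction close: half of it at level n + 1 is
    -- q(r_{n+1}) 2ⁿ, exactly what the new interval loses in (q(r_n) - q(r_{n+1})) 2ⁿ.
    rw [pow_succ] at h1
    simp only [add_zero]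
    linarith

end IsGauge

/-! ### From (q3) to the entropy integral. -/

theorem hasDerivAt_sqrt_log {T x : ℝ} (hx : 0 < x) (hxT : x < T) :
    HasDerivAt (fun ρ => -2 * √(Real.log (T / ρ))) (x * √(Real.log (T / x)))⁻¹ x := by
  have hT : 0 < T := hx.trans hxT
  have hl : 0 < Real.log (T / x) := Real.log_pos ((one_lt_div hx).2 hxT)
  have h1 : HasDerivAt (fun ρ => T / ρ) (-T / x ^ 2) x := by
    simpa [div_eq_mul_inv, neg_div] using (hasDerivAt_inv hx.ne').const_mul T
  have h2 := ((h1.log (by positivity)).sqrt hl.ne').const_mul (-2)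
  refine h2.congr_deriv ?_
  field_simp

/-- The weight in (q3) has the primitive -2√log(T/ρ), and q is at least q(a) on the interval. -/
theorem IsGauge.mul_sqrt_log_sub_le {T : ℝ} {q : ℝ → ℝ} (h : IsGauge T q) {a b : ℝ} (ha : 0 < a)
    (hab : a ≤ b) (hbT : b < T)
    (hint : IntegrableOn (fun ρ => q ρ * (ρ * √(Real.log (T / ρ)))⁻¹) (Ioc a b)) :
    q a * (2 * (√(Real.log (T / a)) - √(Real.log (T / b)))) ≤
      ∫ ρ in Ioc a b, q ρ * (ρ * √(Real.log (T / ρ)))⁻¹ := by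
  have hcont : ContinuousOn (fun ρ => (ρ * √(Real.log (T / ρ)))⁻¹) (uIcc a b) := by
    rw [uIcc_of_le hab]
    intro x hx
    have hx0 : 0 < x := ha.trans_le hx.1
    have hxT : x < T := hx.2.trans_lt hbT
    have hl : 0 < Real.log (T / x) := Real.log_pos ((one_lt_div hx0).2 hxT)
    have hT := h.pos
    refine ContinuousAt.continuousWithinAt ?_
    refine ContinuousAt.inv₀ ?_ (by positivity)
    refine continuousAt_id.mul (ContinuousAt.sqrt (ContinuousAt.log ?_ (by positivity)))
    exact continuousAt_const.div continuousAt_id hx0.ne'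
  have h1 := intervalIntegral.integral_eq_sub_of_hasDerivAt (a := a) (b := b)
    (f := fun ρ => -2 * √(Real.log (T / ρ))) (f' := fun ρ => (ρ * √(Real.log (T / ρ)))⁻¹)
    (fun x hx => by
      rw [uIcc_of_le hab] at hx
      exact hasDerivAt_sqrt_log (ha.trans_le hx.1) (hx.2.trans_lt hbT)) hcont.intervalIntegrable
  rw [intervalIntegral.integral_of_le hab] at h1
  have h2 : q a * (2 * (√(Real.log (T / a)) - √(Real.log (T / b)))) =
      ∫ ρ in Ioc a b, q a * (ρ * √(Real.log (T / ρ)))⁻¹ := by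
    rw [integral_const_mul, h1]; ring
  rw [h2]
  have hi : IntegrableOn (fun ρ => (ρ * √(Real.log (T / ρ)))⁻¹) (Ioc a b) :=
    (intervalIntegrable_iff_integrableOn_Ioc_of_le hab).1 hcont.intervalIntegrable
  refine setIntegral_mono_on (hi.const_mul _) hint measurableSet_Ioc fun x hx => ?_
  have hx0 : 0 < x := ha.trans hx.1
  refine mul_le_mul_of_nonneg_right ?_ (by positivity)
  exact h.monotoneOn ⟨ha.le, hab.trans hbT.le⟩ ⟨hx0.le, hx.2.trans hbT.le⟩ hx.1.le

/-- Under condition (q3) the entropy integral converges and is comparable to its boundary term. -/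
theorem IsGauge.integrableOn_gaugeEntropy {T : ℝ} {q : ℝ → ℝ} (h : IsGauge T q) {C₁ τ : ℝ}
    (hτ : 0 < τ) (hτT : τ < T)
    (hint : IntegrableOn (fun ρ => q ρ * (ρ * √(Real.log (T / ρ)))⁻¹) (Ioc 0 τ))
    (hle : ∫ ρ in Ioc 0 τ, q ρ * (ρ * √(Real.log (T / ρ)))⁻¹ ≤ C₁ * q τ * √(Real.log (T / τ))) :
    IntegrableOn (gaugeEntropy T q) (Ioc 0 (q τ)) ∧
      ∫ ρ in Ioc 0 (q τ), gaugeEntropy T q ρ ≤ 2 * (C₁ + 1) * (q τ * √(Real.log (T / τ))) := by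
  set s := Real.log (T / τ) with hs_def
  have hs : 0 < s := Real.log_pos ((one_lt_div hτ).2 hτT)
  set G := fun ρ => q ρ * (ρ * √(Real.log (T / ρ)))⁻¹ with hG
  set r := doublingScale T s with hr
  have hr0 : r 0 = τ := by
    have hT := h.pos
    simp only [hr, doublingScale, hs_def, pow_zero, one_mul]
    rw [Real.exp_neg, Real.exp_log (by positivity)]
    field_simp
  have hpos : ∀ k, 0 < r k := doublingScale_pos h.pos
  have hltT : ∀ k, r k < T := doublingScale_lt h.pos hs
  have hmem : ∀ k, r k ∈ Icc 0 T := doublingScale_mem_Icc h.pos hs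
  have hanti : Antitone r := antitone_doublingScale h.pos hs
  have hrτ : ∀ k, r k ≤ τ := fun k => hr0 ▸ hanti k.zero_le
  have hsq : ∀ k, √(Real.log (T / r k)) = 2 ^ k * √s := sqrt_log_doublingScale h.pos
  have hqpos : ∀ k, 0 < q (r k) := fun k => h.apply_pos ⟨hpos k, (hltT k).le⟩
  have hqT : ∀ k, q (r k) ≤ q T := fun k => h.monotoneOn (hmem k) ⟨h.pos.le, le_rfl⟩ (hltT k).le
  have hqanti : ∀ k, q (r (k + 1)) ≤ q (r k) := fun k =>
    h.monotoneOn (hmem _) (hmem _) (hanti k.le_succ)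
  have hqanti' : ∀ k, q (r k) ≤ q τ := fun k =>
    h.monotoneOn (hmem _) ⟨hτ.le, hτT.le⟩ (hrτ k)
  -- Between consecutive scales √log(T/·) increases from 2ᵏ√s to 2ᵏ⁺¹√s, so twice the increase is
  -- again 2ᵏ⁺¹√s.
  have hsum : ∀ m, ∑ k ∈ Finset.range m, q (r (k + 1)) * 2 ^ (k + 1) * √s ≤
      ∫ ρ in Ioc (r m) τ, G ρ := by
    intro m
    induction m with
    | zero => simp [hr0]
    | succ m ih =>
      have hu : Ioc (r (m + 1)) τ = Ioc (r (m + 1)) (r m) ∪ Ioc (r m) τ :=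
        (Ioc_union_Ioc_eq_Ioc (hanti m.le_succ) (hrτ m)).symm
      have hi1 : IntegrableOn G (Ioc (r (m + 1)) (r m)) :=
        hint.mono_set (Ioc_subset_Ioc (hpos _).le (hrτ m))
      have hi2 : IntegrableOn G (Ioc (r m) τ) := hint.mono_set (Ioc_subset_Ioc_left (hpos _).le)
      have h1 := h.mul_sqrt_log_sub_le (hpos (m + 1)) (hanti m.le_succ) (hltT m) hi1
      rw [hsq, hsq] at h1
      rw [hu, setIntegral_union (Ioc_disjoint_Ioc_of_le le_rfl) measurableSet_Ioc hi1 hi2,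
        Finset.sum_range_succ]
      have h2 : q (r (m + 1)) * 2 ^ (m + 1) * √s =
        q (r (m + 1)) * (2 * (2 ^ (m + 1) * √s - 2 ^ m * √s)) := by ring
      linarith
  have hGle : ∀ m, ∫ ρ in Ioc (r m) τ, G ρ ≤ C₁ * q τ * √s := by
    intro m
    refine le_trans ?_ hle
    refine setIntegral_mono_set hint ?_ (Ioc_subset_Ioc_left (hpos m).le).eventuallyLE
    refine (ae_restrict_mem measurableSet_Ioc).mono fun x hx => ?_
    have hx0 := hx.1
    have := h.apply_pos ⟨hx.1, hx.2.trans hτT.le⟩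
    simp only [Pi.zero_apply, hG]
    positivity
  have hup : ∀ m, ∫ ρ in Ioc (q (r m)) (q τ), gaugeEntropy T q ρ ≤
      ∑ k ∈ Finset.range m, q (r k) * 2 ^ (k + 1) * √s := by
    intro m
    induction m with
    | zero => simp [hr0]
    | succ m ih =>
      have hu : Ioc (q (r (m + 1))) (q τ) = Ioc (q (r (m + 1))) (q (r m)) ∪ Ioc (q (r m)) (q τ) :=
        (Ioc_union_Ioc_eq_Ioc (hqanti m) (hqanti' m)).symm
      have hτq : q τ ≤ q T := hr0 ▸ hqT 0
      have hi1 := h.integrableOn_gaugeEntropy_Ioc (hqpos (m + 1)) (hqT m)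
      have hi2 := h.integrableOn_gaugeEntropy_Ioc (hqpos m) hτq
      have h1 := h.setIntegral_le_mul_gaugeEntropy (hqanti m) (hqpos (m + 1)) (hqT m)
      rw [h.gaugeEntropy_apply (hmem _), hsq] at h1
      rw [hu, setIntegral_union (Ioc_disjoint_Ioc_of_le le_rfl) measurableSet_Ioc hi1 hi2,
        Finset.sum_range_succ]
      have h2 : (q (r m) - q (r (m + 1))) * (2 ^ (m + 1) * √s) ≤ q (r m) * 2 ^ (m + 1) * √s := by
        rw [mul_assoc]
        refine mul_le_mul_of_nonneg_right ?_ (by positivity)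
        linarith [hqpos (m + 1)]
      linarith
  have hbound : ∀ m, ∫ ρ in Ioc (q (r m)) (q τ), gaugeEntropy T q ρ ≤
      2 * (C₁ + 1) * (q τ * √s) := by
    intro m
    refine (hup m).trans ?_
    -- Shifting the index splits off 2 q(τ)√s and leaves twice the sum in `hsum`, which (q3) bounds
    -- by C₁ q(τ)√s; hence the constant 2(C₁ + 1).
    have h1 : ∑ k ∈ Finset.range m, q (r k) * 2 ^ (k + 1) * √s ≤
        ∑ k ∈ Finset.range (m + 1), q (r k) * 2 ^ (k + 1) * √s := by
      rw [Finset.sum_range_succ]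
      have := hqpos m
      have : 0 ≤ q (r m) * 2 ^ (m + 1) * √s := by positivity
      linarith
    have h2 : ∑ k ∈ Finset.range m, q (r (k + 1)) * 2 ^ (k + 1 + 1) * √s =
        2 * ∑ k ∈ Finset.range m, q (r (k + 1)) * 2 ^ (k + 1) * √s := by
      rw [Finset.mul_sum]
      exact Finset.sum_congr rfl fun k _ => by ring
    rw [Finset.sum_range_succ', h2, hr0] at h1
    have h3 := (hsum m).trans (hGle m)
    norm_num at h1
    linarith
  have hlim : Tendsto (fun k => q (r k)) atTop (𝓝 0) := by
    refine h.tendsto_zero.comp (tendsto_nhdsWithin_iff.2 ⟨tendsto_doublingScale hs, ?_⟩)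
    exact Eventually.of_forall hpos
  have hτq : q τ ≤ q T := hr0 ▸ hqT 0
  -- The integrand is nonnegative, so the uniform bound on the truncated integrals gives convergence
  -- at 0.
  have hI : IntegrableOn (gaugeEntropy T q) (Ioc 0 (q τ)) := by
    refine integrableOn_Ioc_of_intervalIntegral_norm_bounded_left (l := atTop)
      (a := fun k => q (r k)) (I := 2 * (C₁ + 1) * (q τ * √s))
      (fun k => h.integrableOn_gaugeEntropy_Ioc (hqpos k) hτq) hlim
      (Eventually.of_forall fun k => ?_)
    have h1 : ∀ x, ‖gaugeEntropy T q x‖ = gaugeEntropy T q x := fun x =>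
      Real.norm_of_nonneg (gaugeEntropy_nonneg _ _ _)
    simp only [h1]
    exact hbound k
  refine ⟨hI, ?_⟩
  have hc : AECover (volume.restrict (Ioc 0 (q τ))) atTop fun k => Ioc (q (r k)) (q τ) :=
    aecover_Ioc_of_Ioc hlim tendsto_const_nhds
  have h1 := hc.integral_tendsto_of_countably_generated hI
  refine le_of_tendsto h1 (Eventually.of_forall fun k => ?_)
  rw [Measure.restrict_restrict measurableSet_Ioc,
    inter_eq_left.2 (Ioc_subset_Ioc_left (hqpos k).le)]
  exact hbound k

/-! ### Gaussian tails. -/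

section Tail

variable {Ω : Type*} [MeasurableSpace Ω] {P : Measure Ω}

theorem ProbabilityTheory.HasGaussianLaw.hasSubgaussianMGF {Y : Ω → ℝ} (hY : HasGaussianLaw Y P)
    (h0 : ∫ ω, Y ω ∂P = 0) : HasSubgaussianMGF Y (Var[Y; P]).toNNReal P := by
  have h1 := hY.map_eq_gaussianReal
  rw [h0] at h1
  rw [← HasSubgaussianMGF.id_map_iff hY.aemeasurable, h1]
  refine ⟨fun t => integrable_exp_mul_gaussianReal t, fun t => ?_⟩
  rw [mgf_id_gaussianReal]
  simp

theorem ProbabilityTheory.HasGaussianLaw.variance_eq_sq_eLpNorm {Y : Ω → ℝ}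
    (hY : HasGaussianLaw Y P) (h0 : ∫ ω, Y ω ∂P = 0) :
    Var[Y; P] = (eLpNorm Y 2 P).toReal ^ 2 := by
  have := hY.isProbabilityMeasure
  rw [variance_eq_integral hY.aemeasurable, h0,
    hY.memLp_two.eLpNorm_eq_integral_rpow_norm (by norm_num) (by norm_num),
    ENNReal.toReal_ofReal (by positivity)]
  have h1 : 0 ≤ ∫ ω, Y ω ^ 2 ∂P := integral_nonneg fun ω => sq_nonneg _
  simp [← one_div, ← Real.sqrt_eq_rpow, Real.sq_sqrt h1]

/-- The Gaussian tail bound, normalized by the standard deviation (which may vanish). -/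
theorem ProbabilityTheory.HasGaussianLaw.measure_abs_gt_le {Y : Ω → ℝ} (hY : HasGaussianLaw Y P)
    (h0 : ∫ ω, Y ω ∂P = 0) {t : ℝ} (ht : 0 ≤ t) :
    P {ω | t * (eLpNorm Y 2 P).toReal < |Y ω|} ≤ ENNReal.ofReal (2 * Real.exp (-t ^ 2 / 2)) := by
  have hP := hY.isProbabilityMeasure
  have hsub := hY.hasSubgaussianMGF h0
  have hvar := hY.variance_eq_sq_eLpNorm h0
  set σ := (eLpNorm Y 2 P).toReal
  have hσ : 0 ≤ σ := ENNReal.toReal_nonneg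
  rcases hσ.eq_or_lt with hz | hpos
  · rw [hvar, ← hz] at hsub
    -- In the degenerate case Y vanishes almost surely, and the event is null because its inequality
    -- is strict.
    have h1 : Y =ᵐ[P] 0 := by
      refine HasSubgaussianMGF.ae_eq_zero_of_hasSubgaussianMGF_zero ?_
      simpa using hsub
    have h2 : P {ω | t * σ < |Y ω|} = 0 := by
      rw [measure_eq_zero_iff_ae_notMem]
      filter_upwards [h1] with ω hω
      simp [hω, ← hz]
    simp [h2]
  · have hc : ((Var[Y; P]).toNNReal : ℝ) = σ ^ 2 := by
      rw [hvar, Real.coe_toNNReal _ (sq_nonneg _)]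
    have hexp : -(t * σ) ^ 2 / (2 * σ ^ 2) = -t ^ 2 / 2 := by field_simp
    have h1 := hsub.measure_ge_le (ε := t * σ) (by positivity)
    have h2 := hsub.neg.measure_ge_le (ε := t * σ) (by positivity)
    rw [hc, hexp] at h1 h2
    have h3 : {ω | t * σ < |Y ω|} ⊆ {ω | t * σ ≤ Y ω} ∪ {ω | t * σ ≤ (-Y) ω} := by
      intro ω hω
      have hω' : t * σ < |Y ω| := hω
      rcases lt_abs.1 hω' with h | h
      · exact Or.inl h.le
      · exact Or.inr h.le
    have h4 := (measureReal_mono h3).trans (measureReal_union_le (μ := P) _ _)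
    rw [← ENNReal.ofReal_toReal (measure_ne_top P {ω | t * σ < |Y ω|})]
    refine ENNReal.ofReal_le_ofReal ?_
    change P.real _ ≤ _
    linarith

end Tail

theorem summable_exp_neg_four_pow : Summable fun n : ℕ => Real.exp (-(4 : ℝ) ^ n) := by
  have h1 : Summable fun n : ℕ => Real.exp (-(n : ℝ)) := Real.summable_exp_neg_nat
  refine Summable.of_nonneg_of_le (fun n => (Real.exp_pos _).le) (fun n => ?_) h1
  have : (n : ℝ) < 4 ^ n := by exact_mod_cast Nat.lt_pow_self (by norm_num)
  gcongr

/-! ### Increments of the field, separability and chains. -/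

section Field

variable {d : ℕ} {K : Set (EuclideanSpace ℝ (Fin d))} {Ω : Type*} [MeasurableSpace Ω]
  {P : Measure Ω} {X : K → Ω → ℝ} {q : ℝ → ℝ} {C : ℝ}

theorem canonicalMetric_nonneg (x y : K) : 0 ≤ canonicalMetric P X x y := ENNReal.toReal_nonneg

theorem canonicalMetric_comm (x y : K) : canonicalMetric P X x y = canonicalMetric P X y x := by
  unfold canonicalMetric
  rw [← eLpNorm_neg]
  congr 2
  ext ω
  simp

/-- Minkowski's inequality in L²; Gaussianity makes the norms finite, so that `toReal` respects it.
-/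
theorem canonicalMetric_triangle (hX : IsGaussianProcess X P) (x y z : K) :
    canonicalMetric P X x z ≤ canonicalMetric P X x y + canonicalMetric P X y z := by
  have h1 := (hX.hasGaussianLaw_fun_sub (s := x) (t := y)).memLp_two
  have h2 := (hX.hasGaussianLaw_fun_sub (s := y) (t := z)).memLp_two
  unfold canonicalMetric
  rw [← ENNReal.toReal_add h1.2.ne h2.2.ne]
  refine ENNReal.toReal_mono (ENNReal.add_ne_top.2 ⟨h1.2.ne, h2.2.ne⟩) ?_
  refine le_trans (le_of_eq ?_) (eLpNorm_add_le h1.1 h2.1 (by norm_num))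
  congr 1
  ext ω
  simp

theorem IsCenteredHatGaussian.measure_lt_le (hX : IsCenteredHatGaussian P X q C) (x y : K) {t : ℝ}
    (ht : 0 ≤ t) :
    P {ω | t * canonicalMetric P X x y < |X x ω - X y ω|} ≤
      ENNReal.ofReal (2 * Real.exp (-t ^ 2 / 2)) := by
  refine (hX.gaussian.hasGaussianLaw_fun_sub (s := x) (t := y)).measure_abs_gt_le ?_ ht
  rw [integral_sub (hX.gaussian.hasGaussianLaw_eval x).integrable
    (hX.gaussian.hasGaussianLaw_eval y).integrable, hX.centered, hX.centered, sub_zero]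

/-- Borel-Cantelli for the increments of a Gaussian field over finite sets of pairs whose
cardinality is at most `B * exp (a * 4ⁿ)`. -/
theorem IsCenteredHatGaussian.ae_eventually_le (hX : IsCenteredHatGaussian P X q C)
    {S : ℕ → Finset (K × K)} {B a t : ℝ} (ht : 0 ≤ t) (hta : 2 * (a + 1) ≤ t ^ 2)
    (hcard : ∀ n, ((S n).card : ℝ) ≤ B * Real.exp (a * 4 ^ n)) :
    ∀ᵐ ω ∂P, ∀ᶠ n in atTop, ∀ p ∈ S n,
      |X p.1 ω - X p.2 ω| ≤ t * 2 ^ n * canonicalMetric P X p.1 p.2 := by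
  set A : ℕ → Set Ω := fun n =>
    ⋃ p ∈ S n, {ω | t * 2 ^ n * canonicalMetric P X p.1 p.2 < |X p.1 ω - X p.2 ω|} with hA
  have hle : ∀ n, P (A n) ≤ ENNReal.ofReal (2 * B * Real.exp (-(4 : ℝ) ^ n)) := by
    intro n
    have hB : 0 ≤ B := by
      have := (Nat.cast_nonneg _).trans (hcard n)
      exact nonneg_of_mul_nonneg_left this (Real.exp_pos _)
    calc P (A n) ≤ ∑ p ∈ S n, P {ω | t * 2 ^ n * canonicalMetric P X p.1 p.2 <
            |X p.1 ω - X p.2 ω|} := measure_biUnion_finset_le _ _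
      _ ≤ ∑ p ∈ S n, ENNReal.ofReal (2 * Real.exp (-(t * 2 ^ n) ^ 2 / 2)) :=
          Finset.sum_le_sum fun p _ => hX.measure_lt_le p.1 p.2 (by positivity)
      _ = ENNReal.ofReal ((S n).card * (2 * Real.exp (-(t * 2 ^ n) ^ 2 / 2))) := by
          rw [Finset.sum_const, nsmul_eq_mul, ENNReal.ofReal_mul (by positivity)]
          simp
      _ ≤ ENNReal.ofReal (2 * B * Real.exp (-(4 : ℝ) ^ n)) := by
          refine ENNReal.ofReal_le_ofReal ?_
          have h4 : ((2 : ℝ) ^ n) ^ 2 = 4 ^ n := by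
            rw [← pow_mul, mul_comm, pow_mul]; norm_num
          -- The condition t²/2 ≥ a + 1 leaves a factor exp(-4ⁿ) after the cardinality is paid for.
          have h1 : Real.exp (a * 4 ^ n) * Real.exp (-(t * 2 ^ n) ^ 2 / 2) ≤
              Real.exp (-(4 : ℝ) ^ n) := by
            rw [← Real.exp_add, mul_pow, h4]
            refine Real.exp_le_exp.2 ?_
            have := mul_le_mul_of_nonneg_right hta (by positivity : (0 : ℝ) ≤ 4 ^ n)
            linarith
          calc _ ≤ (B * Real.exp (a * 4 ^ n)) * (2 * Real.exp (-(t * 2 ^ n) ^ 2 / 2)) := by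
                gcongr
                exact hcard n
            _ = 2 * B * (Real.exp (a * 4 ^ n) * Real.exp (-(t * 2 ^ n) ^ 2 / 2)) := by ring
            _ ≤ _ := by gcongr
  have hsum : ∑' n, P (A n) ≠ ∞ :=
    ne_top_of_le_ne_top (summable_exp_neg_four_pow.mul_left (2 * B)).tsum_ofReal_ne_top
      (ENNReal.tsum_le_tsum hle)
  filter_upwards [ae_eventually_notMem hsum] with ω hω
  filter_upwards [hω] with n hn p hp
  by_contra! hlt
  exact hn (mem_biUnion hp hlt)

/-- A separable field is determined, over any neighbourhood, by its values on the dense set. -/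
theorem exists_mem_dense_near {f : K → ℝ} {D : Set K}
    (hD : ∀ (U : Set K) (F : Set ℝ), IsOpen U → IsClosed F →
      (∀ s ∈ D ∩ U, f s ∈ F) → ∀ x ∈ U, f x ∈ F) (x : K) {r θ : ℝ} (hr : 0 < r) (hθ : 0 < θ) :
    ∃ s ∈ D, dist x s < r ∧ |f x - f s| < θ := by
  -- The closed constraint is the closure of the values taken on the part of D in the ball.
  have h1 := hD (Metric.ball x r) (closure (f '' (D ∩ Metric.ball x r))) Metric.isOpen_ball
    isClosed_closure (fun s hs => subset_closure ⟨s, hs, rfl⟩) x (Metric.mem_ball_self hr)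
  obtain ⟨_, ⟨s, hs, rfl⟩, h2⟩ := Metric.mem_closure_iff.1 h1 θ hθ
  exact ⟨s, hs.1, by rw [dist_comm]; exact hs.2, h2⟩

/-- The chaining estimate along one path of nets: the difference of the values at a point and at its
projection is at most a sum of increments over the links. -/
theorem abs_sub_le_of_chain {f : ℕ → ℝ} {a : ℝ} {c : ℕ → ℝ} {n : ℕ} {J : ℝ}
    (hlink : ∀ k, n ≤ k → |f (k + 1) - f k| ≤ c k)
    (hsum : ∀ m, ∑ k ∈ Finset.range m, c (n + k) ≤ J) (hlim : Tendsto f atTop (𝓝 a)) :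
    |a - f n| ≤ J := by
  have h1 : ∀ m, |f (n + m) - f n| ≤ ∑ k ∈ Finset.range m, c (n + k) := by
    intro m
    induction m with
    | zero => simp
    | succ m ih =>
      rw [Finset.sum_range_succ]
      have h2 := hlink (n + m) (Nat.le_add_right _ _)
      have h3 := abs_sub_le (f (n + m + 1)) (f (n + m)) (f n)
      rw [← add_assoc]
      linarith
  have h2 : Tendsto (fun m => |f (n + m) - f n|) atTop (𝓝 |a - f n|) := by
    have : Tendsto (fun m => f (n + m)) atTop (𝓝 a) := by
      simpa only [add_comm n] using (tendsto_add_atTop_iff_nat n).2 hlim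
    exact (this.sub_const _).abs
  exact le_of_tendsto h2 (Eventually.of_forall fun m => (h1 m).trans (hsum m))

end Field

/-! ### The Dudley bound and the normalized supremum. -/

section Main

variable {d : ℕ} {K : Set (EuclideanSpace ℝ (Fin d))} {Ω : Type*} [MeasurableSpace Ω]
  {P : Measure Ω} {X : K → Ω → ℝ} {q : ℝ → ℝ} {C : ℝ}

theorem IsGauge.sum_doublingScale_le_integral {T : ℝ} (h : IsGauge T q) {n : ℕ}
    (hint : IntegrableOn (gaugeEntropy T q) (Ioc 0 (q (doublingScale T 1 n)))) (m : ℕ) :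
    ∑ k ∈ Finset.range m, q (doublingScale T 1 (n + k)) * 2 ^ (n + k) ≤
      2 * ∫ ρ in Ioc 0 (q (doublingScale T 1 n)), gaugeEntropy T q ρ := by
  have h1 := h.sum_doublingScale_le m n hint
  rw [Finset.sum_range_succ] at h1
  have h2 := h.apply_pos (doublingScale_mem h.pos one_pos n)
  have h3 := h.apply_pos (doublingScale_mem h.pos one_pos (n + m))
  have h4 : 0 ≤ q (doublingScale T 1 n) * 2 ^ n := by positivity
  have h5 : 0 ≤ q (doublingScale T 1 (n + m)) * 2 ^ (n + m) := by positivity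
  linarith

/-- These are the terms of a series with bounded partial sums. Their decay lets the values at the
net projections of a point of D converge to the value at that point. -/
theorem IsGauge.tendsto_doublingScale_mul {T : ℝ} (h : IsGauge T q) {n : ℕ}
    (hint : IntegrableOn (gaugeEntropy T q) (Ioc 0 (q (doublingScale T 1 n)))) :
    Tendsto (fun k => q (doublingScale T 1 k) * 2 ^ k) atTop (𝓝 0) := by
  have h1 : Summable fun k => q (doublingScale T 1 (n + k)) * 2 ^ (n + k) := by
    refine summable_of_sum_range_le (fun k => ?_) (h.sum_doublingScale_le_integral hint)
    have := h.apply_pos (doublingScale_mem h.pos one_pos (n + k))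
    positivity
  have h2 := h1.tendsto_atTop_zero
  simp only [add_comm n] at h2
  exact (tendsto_add_atTop_iff_nat n).1 h2

/-- Nets of a compact set along doubling scales, with exponential cardinality. -/
theorem exists_doublingScale_nets (hK : IsCompact K) (hT : 0 < Metric.diam K) :
    ∃ (B : ℝ) (N : ℕ → Finset K),
      (∀ n, ∀ x : K, ∃ u ∈ N n, dist x u ≤ doublingScale (Metric.diam K) 1 n) ∧
      ∀ n, ((N n).card : ℝ) ≤ B * Real.exp (d * 4 ^ n) := by
  set T := Metric.diam K with hT_def
  have hne : K.Nonempty := by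
    by_contra! h
    simp [hT_def, h] at hT
  obtain ⟨R, hR, hnet⟩ := exists_finset_net hK.isBounded hne
  choose N hN hcard using fun n => hnet (doublingScale T 1 n) (doublingScale_pos hT n)
  refine ⟨(R / T + 3) ^ d, N, hN, fun n => (hcard n).trans ?_⟩
  have h1 : R / doublingScale T 1 n = R / T * Real.exp (4 ^ n) := by
    rw [doublingScale, mul_one, Real.exp_neg]
    field_simp
  have h2 : (1 : ℝ) ≤ Real.exp (4 ^ n) := Real.one_le_exp (by positivity)
  have h3 : Real.exp (d * 4 ^ n) = Real.exp (4 ^ n) ^ d := Real.exp_nat_mul _ _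
  rw [h1, h3, ← mul_pow]
  refine pow_le_pow_left₀ (by positivity) ?_ d
  linarith

/-- Dudley's modulus of continuity for Gaussian fields dominated by a gauge. -/
theorem IsCenteredHatGaussian.dudleyBound (hX : IsCenteredHatGaussian P X q C)
    (hsep : IsSeparableField P X) (hK : IsCompact K) (hq : IsGauge (Metric.diam K) q) (hC : 0 < C)
    {b₀ : ℝ} (hb₀ : 0 < b₀) (hint : IntegrableOn (gaugeEntropy (Metric.diam K) q) (Ioc 0 b₀))
    {t : ℝ} (ht : 0 ≤ t) (htd : 2 * (8 * d + 1) ≤ t ^ 2) :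
    DudleyBound P X q (16 * t * C + 2 * t) := by
  classical
  set T := Metric.diam K with hT_def
  set r := doublingScale T 1 with hr
  set b : ℕ → ℝ := fun n => q (r n) with hb
  have hmem : ∀ n, r n ∈ Ioc 0 T := doublingScale_mem hq.pos one_pos
  have hmem' : ∀ n, r n ∈ Icc 0 T := doublingScale_mem_Icc hq.pos one_pos
  have hbpos : ∀ n, 0 < b n := fun n => hq.apply_pos (hmem n)
  have hbT : ∀ n, b n ≤ q T := fun n => hq.monotoneOn (hmem' n) ⟨hq.pos.le, le_rfl⟩ (hmem n).2
  have hbanti : Antitone b := fun m n hmn =>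
    hq.monotoneOn (hmem' n) (hmem' m) (antitone_doublingScale hq.pos one_pos hmn)
  have hblim : Tendsto b atTop (𝓝 0) :=
    hq.tendsto_zero.comp (tendsto_nhdsWithin_iff.2
      ⟨tendsto_doublingScale one_pos, Eventually.of_forall fun n => (hmem n).1⟩)
  obtain ⟨n₁, hn₁⟩ := ((tendsto_order.1 hblim).2 b₀ hb₀).exists
  have hintn : ∀ n, n₁ ≤ n → IntegrableOn (gaugeEntropy T q) (Ioc 0 (b n)) := fun n hn =>
    hint.mono_set (Ioc_subset_Ioc_right ((hbanti hn).trans hn₁.le))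
  have hblim2 : Tendsto (fun k => b k * 2 ^ k) atTop (𝓝 0) :=
    hq.tendsto_doublingScale_mul (hintn n₁ le_rfl)
  have hdle : ∀ {x y : K} {n : ℕ}, dist x y ≤ r n → canonicalMetric P X x y ≤ C * b n := by
    intro x y n hxy
    refine (hX.metric_le x y).trans (mul_le_mul_of_nonneg_left ?_ hC.le)
    exact hq.monotoneOn ⟨dist_nonneg, hxy.trans (hmem n).2⟩ (hmem' n) hxy
  have htri := canonicalMetric_triangle hX.gaussian
  have hcomm := canonicalMetric_comm (P := P) (X := X)
  obtain ⟨B, N, hN, hcard⟩ := exists_doublingScale_nets hK hq.pos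
  choose π hπN hπd using hN
  obtain ⟨D, hDc, -, hD⟩ := hsep
  have hB : 0 ≤ B :=
    nonneg_of_mul_nonneg_left ((Nat.cast_nonneg _).trans (hcard 0)) (Real.exp_pos _)
  -- Pairs from the union cover both the links of chains and the pairs inside one net. The exponent
  -- is 2 · d · 4ⁿ⁺¹ = 8d · 4ⁿ, the source of 8d in the condition on t.
  have hcard2 : ∀ n, ((((N n ∪ N (n + 1)) ×ˢ (N n ∪ N (n + 1))).card : ℕ) : ℝ) ≤
      4 * B ^ 2 * Real.exp (8 * d * 4 ^ n) := by
    intro n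
    have h1 : ((N n ∪ N (n + 1)).card : ℝ) ≤ (N n).card + (N (n + 1)).card := by
      exact_mod_cast Finset.card_union_le _ _
    have h2 : B * Real.exp (d * 4 ^ n) ≤ B * Real.exp (d * 4 ^ (n + 1)) := by
      gcongr
      · norm_num
      · omega
    have h3 : ((N n ∪ N (n + 1)).card : ℝ) ≤ 2 * B * Real.exp (d * 4 ^ (n + 1)) := by
      linarith [hcard n, hcard (n + 1)]
    rw [Finset.card_product, Nat.cast_mul]
    calc _ ≤ (2 * B * Real.exp (d * 4 ^ (n + 1))) * (2 * B * Real.exp (d * 4 ^ (n + 1))) := by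
          gcongr
      _ = 4 * B ^ 2 * (Real.exp (d * 4 ^ (n + 1)) * Real.exp (d * 4 ^ (n + 1))) := by ring
      _ = _ := by rw [← Real.exp_add]; congr 2; ring
  have H1 := hX.ae_eventually_le ht htd hcard2
  -- No path continuity is available, so convergence along the projections is proved by a separate
  -- Borel-Cantelli argument for each s, with one pair per level; countability of D unites the null
  -- events.
  have H2 : ∀ᵐ ω ∂P, ∀ s ∈ D, ∀ᶠ n in atTop,
      |X s ω - X (π n s) ω| ≤ t * 2 ^ n * canonicalMetric P X s (π n s) := by
    refine (ae_ball_iff hDc).2 fun s _ => ?_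
    have h1 := hX.ae_eventually_le (S := fun n => {(s, π n s)}) (B := 1) (a := 0) ht
      (by have : (0 : ℝ) ≤ d := Nat.cast_nonneg d
          linarith) (by simp)
    filter_upwards [h1] with ω hω
    filter_upwards [hω] with n hn using hn _ (Finset.mem_singleton_self _)
  filter_upwards [H1, H2, hD] with ω h1 h2 h3
  obtain ⟨n₂, hn₂⟩ := eventually_atTop.1 h1
  set f : K → ℝ := fun x => X x ω with hf
  set J : ℕ → ℝ := fun n => ∫ ρ in Ioc 0 (b n), gaugeEntropy T q ρ with hJ
  have hchain : ∀ n, max n₁ n₂ ≤ n → ∀ s ∈ D, |f s - f (π n s)| ≤ 4 * t * C * J n := by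
    intro n hn s hs
    refine abs_sub_le_of_chain (f := fun k => f (π k s)) (c := fun k => 2 * t * C * (b k * 2 ^ k))
      (fun k hk => ?_) (fun m => ?_) ?_
    · have h4 := hn₂ k ((le_max_right _ _).trans (hn.trans hk)) (π (k + 1) s, π k s)
        (Finset.mem_product.2 ⟨Finset.mem_union_right _ (hπN _ _),
          Finset.mem_union_left _ (hπN _ _)⟩)
      refine h4.trans ?_
      have h5 : canonicalMetric P X (π (k + 1) s) (π k s) ≤ C * b k + C * b k := by
        refine (htri _ s _).trans (add_le_add ?_ (hdle (hπd k s)))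
        rw [hcomm]
        exact (hdle (hπd (k + 1) s)).trans (mul_le_mul_of_nonneg_left (hbanti k.le_succ) hC.le)
      calc _ ≤ t * 2 ^ k * (C * b k + C * b k) := by gcongr
        _ = _ := by ring
    · rw [← Finset.mul_sum]
      have h4 := hq.sum_doublingScale_le_integral (hintn n ((le_max_left _ _).trans hn)) m
      calc _ ≤ 2 * t * C * (2 * J n) := by gcongr
        _ = _ := by ring
    · rw [tendsto_iff_dist_tendsto_zero]
      have h4 : Tendsto (fun k => t * C * (b k * 2 ^ k)) atTop (𝓝 0) := by
        simpa using hblim2.const_mul (t * C)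
      refine tendsto_of_tendsto_of_tendsto_of_le_of_le' tendsto_const_nhds h4
        (Eventually.of_forall fun k => dist_nonneg) ?_
      filter_upwards [h2 s hs] with k hk
      rw [dist_comm, Real.dist_eq]
      calc _ ≤ t * 2 ^ k * canonicalMetric P X s (π k s) := hk
        _ ≤ t * 2 ^ k * (C * b k) := by gcongr; exact hdle (hπd k s)
        _ = _ := by ring
  -- Chains start only at points of D; separability replaces x by such a point at the price of an
  -- arbitrarily small θ.
  have happrox : ∀ n, max n₁ n₂ ≤ n → ∀ (x : K) (θ : ℝ), 0 < θ → ∃ u ∈ N n,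
      canonicalMetric P X x u ≤ 2 * C * b n ∧ |f x - f u| ≤ 4 * t * C * J n + θ := by
    intro n hn x θ hθ
    obtain ⟨s, hsD, hxs, hfs⟩ := exists_mem_dense_near h3 x (hmem n).1 hθ
    refine ⟨π n s, hπN n s, ?_, ?_⟩
    · have := htri x s (π n s)
      linarith [hdle hxs.le, hdle (hπd n s)]
    · have := abs_sub_le (f x) (f s) (f (π n s))
      have h4 : |f x - f s| < θ := hfs
      linarith [hchain n hn s hsD]
  refine ⟨b (max n₁ n₂), hbpos _, fun ε hε x y hxy => ?_⟩
  change |f x - f y| ≤ (16 * t * C + 2 * t) * ∫ ρ in Ioc 0 ε, gaugeEntropy T q ρ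
  have hex : ∃ n, b n ≤ ε := ((tendsto_order.1 hblim).2 ε hε.1).exists.imp fun _ h => h.le
  obtain ⟨n, hn0, hnε, hnε'⟩ : ∃ n, max n₁ n₂ ≤ n ∧ b (n + 1) ≤ ε ∧ ε < b n := by
    have hfind := Nat.find_spec hex
    have hlt : max n₁ n₂ < Nat.find hex := by
      by_contra! h
      exact absurd (hfind.trans_lt hε.2) (not_lt.2 (hbanti h))
    obtain ⟨n, hn⟩ := Nat.exists_eq_succ_of_ne_zero (Nat.ne_zero_of_lt hlt)
    refine ⟨n, by omega, by rwa [hn] at hfind, ?_⟩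
    exact not_le.1 (Nat.find_min hex (by omega))
  have hn1 : max n₁ n₂ ≤ n + 1 := by omega
  have hintε : IntegrableOn (gaugeEntropy T q) (Ioc 0 ε) :=
    (hintn n (by omega)).mono_set (Ioc_subset_Ioc_right hnε'.le)
  set I := ∫ ρ in Ioc 0 ε, gaugeEntropy T q ρ with hI
  have hJI : J (n + 1) ≤ I :=
    setIntegral_mono_set hintε (Eventually.of_forall fun _ => gaugeEntropy_nonneg _ _ _)
      (Ioc_subset_Ioc_right hnε).eventuallyLE
  -- Since ε < q(r_n), the integrand is at least 2ⁿ on all of (0, ε].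
  have hεI : 2 ^ (n + 1) * ε ≤ 2 * I := by
    have hεT : ε ∈ Ioc 0 (q T) := ⟨hε.1, hnε'.le.trans (hbT n)⟩
    have h4 := hq.mul_gaugeEntropy_le_setIntegral hε.1.le le_rfl hεT hintε
    have h5 := hq.antitoneOn_gaugeEntropy hεT ⟨hbpos n, hbT n⟩ hnε'.le
    rw [hq.gaugeEntropy_apply (hmem' n), sqrt_log_doublingScale hq.pos, Real.sqrt_one,
      mul_one] at h5
    have h6 := mul_le_mul_of_nonneg_left h5 hε.1.le
    rw [sub_zero] at h4
    rw [pow_succ]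
    linarith
  have hbI : b (n + 1) * 2 ^ (n + 1) ≤ 2 * I := by
    have h4 := hq.sum_doublingScale_le_integral (hintn (n + 1) (by omega)) 1
    simp only [Finset.range_one, Finset.sum_singleton, add_zero] at h4
    have : b (n + 1) * 2 ^ (n + 1) ≤ 2 * J (n + 1) := h4
    linarith
  -- The two chains cost 4tC I each; the increment between the net points costs 8tC I + 2t I. The
  -- total is (16tC + 2t) I.
  refine le_of_forall_pos_le_add fun θ hθ => ?_
  obtain ⟨u, huN, hxu, hfu⟩ := happrox (n + 1) hn1 x (θ / 2) (half_pos hθ)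
  obtain ⟨v, hvN, hyv, hfv⟩ := happrox (n + 1) hn1 y (θ / 2) (half_pos hθ)
  have huv := hn₂ (n + 1) (by omega) (u, v) (Finset.mem_product.2
    ⟨Finset.mem_union_left _ huN, Finset.mem_union_left _ hvN⟩)
  have hduv : canonicalMetric P X u v ≤ 4 * C * b (n + 1) + ε := by
    have h4 := htri u x v
    have h5 := htri x y v
    rw [hcomm u x] at h4
    linarith
  have huv' : |f u - f v| ≤ t * 2 ^ (n + 1) * (4 * C * b (n + 1) + ε) :=
    huv.trans (by gcongr)
  have h4 : |f x - f y| ≤ |f x - f u| + |f u - f v| + |f y - f v| := by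
    have := abs_sub_le (f x) (f u) (f y)
    have := abs_sub_le (f u) (f v) (f y)
    rw [abs_sub_comm (f y)]
    linarith
  have h5 : t * 2 ^ (n + 1) * (4 * C * b (n + 1) + ε) ≤ 8 * t * C * I + 2 * t * I := by
    have h6 := mul_le_mul_of_nonneg_left hbI (by positivity : 0 ≤ 4 * t * C)
    have h7 := mul_le_mul_of_nonneg_left hεI ht
    linarith
  have h6 : 4 * t * C * J (n + 1) ≤ 4 * t * C * I := by gcongr
  linarith

theorem DudleyBound.mono {A A' : ℝ} (h : DudleyBound P X q A) (hA : A ≤ A') :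
    DudleyBound P X q A' := by
  filter_upwards [h] with ω hω
  obtain ⟨η, hη, h1⟩ := hω
  refine ⟨η, hη, fun ε hε x y hxy => (h1 ε hε x y hxy).trans ?_⟩
  exact mul_le_mul_of_nonneg_right hA (integral_nonneg fun _ => Real.sqrt_nonneg _)

theorem monotone_normalizedSup (ω : Ω) : Monotone fun ε => normalizedSup P X q ε ω := by
  intro ε ε' hε
  exact iSup_mono fun x => iSup_mono fun y => iSup_mono' fun h => ⟨h.trans hε, le_rfl⟩

/-- The Dudley bound and the comparison of the entropy integral with its boundary term yield a
uniform bound for the normalized increments. -/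
theorem DudleyBound.exists_tendsto_normalizedSup {A c : ℝ} (h : DudleyBound P X q A) (hA : 0 ≤ A)
    (hq : IsGauge (Metric.diam K) q) {τ₁ : ℝ} (hτ₁ : τ₁ ∈ Ioc 0 (Metric.diam K))
    (hint : IntegrableOn (gaugeEntropy (Metric.diam K) q) (Ioc 0 (q τ₁)))
    (hle : ∀ τ ∈ Ioc 0 τ₁, ∫ ρ in Ioc 0 (q τ), gaugeEntropy (Metric.diam K) q ρ ≤
      c * (q τ * √(Real.log (Metric.diam K / τ)))) :
    ∀ᵐ ω ∂P, ∃ L : ℝ≥0∞, Tendsto (fun ε => normalizedSup P X q ε ω) (𝓝[>] 0) (𝓝 L) ∧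
      L ≤ ENNReal.ofReal (A * c) := by
  set T := Metric.diam K with hT_def
  have hqτ₁ : 0 < q τ₁ := hq.apply_pos hτ₁
  filter_upwards [h] with ω hω
  obtain ⟨η, hη, h1⟩ := hω
  -- Monotonicity in ε gives the limit, so one bound for small ε suffices.
  have hlim := (monotone_normalizedSup (P := P) (X := X) (q := q) ω).tendsto_nhdsGT 0
  refine ⟨_, hlim, le_of_tendsto hlim ?_⟩
  have hzero : Tendsto (fun ε => A * ∫ ρ in Ioc 0 ε, gaugeEntropy T q ρ) (𝓝[>] 0) (𝓝 0) := by
    have h2 := intervalIntegral.continuousOn_primitive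
      ((integrableOn_Icc_iff_integrableOn_Ioc (f := gaugeEntropy T q) (μ := volume)).2 hint) 0
      ⟨le_rfl, hqτ₁.le⟩
    rw [ContinuousWithinAt] at h2
    have h3 := (h2.mono_left (nhdsWithin_mono _ Ioc_subset_Icc_self)).const_mul A
    rw [nhdsWithin_Ioc_eq_nhdsGT hqτ₁] at h3
    simpa using h3
  filter_upwards [Ioo_mem_nhdsGT (lt_min hη hqτ₁)] with ε hε
  refine iSup_le fun x => iSup_le fun y => iSup_le fun hxy => ?_
  refine ENNReal.div_le_of_le_mul ?_
  rcases (canonicalMetric_nonneg (P := P) (X := X) x y).eq_or_lt with h0 | hpos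
  · have h2 : |X x ω - X y ω| ≤ 0 := by
      refine ge_of_tendsto hzero ?_
      filter_upwards [Ioo_mem_nhdsGT hη] with ε' hε'
      exact h1 ε' hε' x y (h0 ▸ hε'.1.le)
    rw [ENNReal.ofReal_of_nonpos h2]
    exact bot_le
  · set δ := canonicalMetric P X x y
    have hδτ : δ < q τ₁ := hxy.trans_lt (hε.2.trans_le (min_le_right _ _))
    have hδη : δ < η := hxy.trans_lt (hε.2.trans_le (min_le_left _ _))
    have hδT : δ ∈ Ioc 0 (q T) := ⟨hpos, hδτ.le.trans
      (hq.monotoneOn ⟨hτ₁.1.le, hτ₁.2⟩ ⟨hq.pos.le, le_rfl⟩ hτ₁.2)⟩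
    obtain ⟨τ, hτ, hτδ⟩ := hq.exists_eq hδT
    have hττ₁ : τ < τ₁ := by
      refine (hq.strictMonoOn.lt_iff_lt ⟨hτ.1.le, hτ.2⟩ ⟨hτ₁.1.le, hτ₁.2⟩).1 ?_
      rwa [hτδ]
    have h2 := hle τ ⟨hτ.1, hττ₁.le⟩
    rw [← hq.gaugeEntropy_apply ⟨hτ.1.le, hτ.2⟩, hτδ] at h2
    have h3 := h1 δ ⟨hpos, hδη⟩ x y le_rfl
    rw [← ENNReal.ofReal_mul' (mul_nonneg hpos.le (Real.sqrt_nonneg _))]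
    refine ENNReal.ofReal_le_ofReal (h3.trans ?_)
    rw [mul_assoc]
    exact mul_le_mul_of_nonneg_left h2 hA

end Main

/-! ### Choice of the constants. -/

theorem proposition2p2 (d : ℕ) (C : ℝ) (hC : 0 < C) :
    ∃ C₀ : ℝ, 0 < C₀ ∧
      ∀ {Ω : Type*} [MeasurableSpace Ω] (P : Measure Ω) [IsProbabilityMeasure P]
        (K : Set (EuclideanSpace ℝ (Fin d))) (_ : IsCompact K)
        (q : ℝ → ℝ) (_ : IsGauge (Metric.diam K) q)
        (_ : CondQ1 (Metric.diam K) q) (_ : CondQ2 q)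
        (C₁ : ℝ) (_ : 0 < C₁) (_ : CondQ3 (Metric.diam K) q C₁)
        (X : K → Ω → ℝ) (_ : IsCenteredHatGaussian P X q C) (_ : IsSeparableField P X),
        DudleyBound P X q C₀ ∧
        ∀ᵐ ω ∂P, ∃ L : ℝ≥0∞,
          Tendsto (fun ε => normalizedSup P X q ε ω) (𝓝[>] 0) (𝓝 L) ∧
          L ≤ ENNReal.ofReal (C₀ * (C₁ + 1)) := by
  set t : ℝ := √(2 * (8 * d + 1)) with ht
  have htpos : 0 < t := Real.sqrt_pos.2 (by positivity)
  have htsq : 2 * (8 * (d : ℝ) + 1) ≤ t ^ 2 := (Real.sq_sqrt (by positivity)).ge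
  have hA : 0 < 16 * t * C + 2 * t := by positivity
  -- The Dudley bound holds with half of this constant; the factor 2 absorbs the one in 2(C₁ + 1),
  -- so that a single C₀ serves both claims.
  refine ⟨2 * (16 * t * C + 2 * t), by positivity, ?_⟩
  intro Ω _ P _ K hK q hq _ _ C₁ _ hq3 X hX hsep
  obtain ⟨τ₀, hτ₀, h3⟩ := hq3
  have hT := hq.pos
  -- The cutoff at half the diameter keeps τ strictly below T, where log(T/τ) is positive.
  have key : ∀ τ ∈ Ioc 0 (min τ₀ (Metric.diam K / 2)), _ := fun τ hτ =>
    hq.integrableOn_gaugeEntropy hτ.1 ((hτ.2.trans (min_le_right _ _)).trans_lt (half_lt_self hT))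
      (h3 τ ⟨hτ.1, hτ.2.trans (min_le_left _ _)⟩).1 (h3 τ ⟨hτ.1, hτ.2.trans (min_le_left _ _)⟩).2
  have hτ₁ : 0 < min τ₀ (Metric.diam K / 2) := lt_min hτ₀.1 (half_pos hT)
  have hτ₁' : min τ₀ (Metric.diam K / 2) ∈ Ioc 0 (Metric.diam K) :=
    ⟨hτ₁, (min_le_left _ _).trans hτ₀.2⟩
  have hint := (key _ ⟨hτ₁, le_rfl⟩).1
  have hdud := hX.dudleyBound hsep hK hq hC (hq.apply_pos hτ₁') hint htpos.le htsq
  refine ⟨hdud.mono (by linarith), ?_⟩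
  have hlim := hdud.exists_tendsto_normalizedSup hA.le hq hτ₁' hint fun τ hτ => (key τ hτ).2
  rwa [show (16 * t * C + 2 * t) * (2 * (C₁ + 1)) = 2 * (16 * t * C + 2 * t) * (C₁ + 1) by
    ring] at hlim
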